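/- Consider the plane $\mathbb R^2$ with $\hat{\mathbf u}(\theta)=(\cos\theta,\sin\theta)$, the closed target disc $\{\|\mathbf x\|\le r_T\}$ with $r_T>0$, and let $\tilde\rho_T=\rho_T+r_T$ be the radius of the outer boundary of the target's sensing region. An intruder, with speed limit $\nu\in(0,1)$ and sensing radius $\rho_A\ge 0$, arrives at $\tilde\rho_T\hat{\mathbf u}(\theta_A)$ while a defender, with speed limit $1$, is located at $r\hat{\mathbf u}(\theta_D)$, where $0\le r\le\tilde\rho_T$. Both have dynamics $\dot{\mathbf x}=v\,\hat{\mathbf u}(\psi)$ with measurable controls: speed $v$, bounded in absolute value by the speed limit, and heading $\psi$. Assume $$\max\Big\{\Big(1+\tfrac{2\nu}{1-\nu^2}\Big)\rho_A,\ \nu r_T+\tfrac{2\rho_A\nu^2}{1-\nu^2}\Big\}\le\rho_T .$$ A defender strategy maps intruder trajectories to defender trajectories and is nonanticipative: the defender's motion up to time $t$ depends only on the intruder's positions up to time $t$. The intruder is captured before breach if at some finite time $T\ge 0$ the two positions coincide and the intruder was not in the target at any time $t<T$. Suppose that $$|\theta_A-\theta_D|\le\begin{cases}\Theta_{\rm g}&\text{if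 } r>\frac{\rho_T}{\nu}-r_T,\\ \pi&\text{otherwise,}\end{cases}$$ where $$\Theta_{\rm g}=2\cos^{-1}\!\left(\sqrt{\frac{\big((r_T+\nu r)^2-(\tilde\rho_T-\nu r_T)^2\big)\big((\tilde\rho_T+\nu r_T)^2-(\nu r-r_T)^2\big)}{16\nu^2r_T^2\,r\,\tilde\rho_T}}\right)$$ (the radicand lies in $[0,1]$ in the first case). Then the defender can capture the intruder: (a) there is a defender strategy under which every intruder trajectory starting at $\tilde\rho_T\hat{\mathbf u}(\theta_A)$ is captured before breach; (b) if moreover the intruder does not sense the defender on arrival, i.e. $\|\tilde\rho_T\hat{\mathbf u}(\theta_A)-r\hat{\mathbf u}(\theta_D)\|>\rho_A$, then there is a defender strategy under which every intruder that moves radially towards the target center at speed $\nu$ until it is within distance $\rho_A$ of the defender (and arbitrarily afterwards) is captured before breach without having left the disc $\{\|\mathbf x\|\le\tilde\rho_T\}$. -/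

import Mathlib

open Set MeasureTheory

noncomputable section

/-- The Euclidean plane. -/
abbrev Plane := EuclideanSpace ℝ (Fin 2)

/-- The unit vector `(cos θ, sin θ)`. -/
def unitVec (θ : ℝ) : Plane := !₂[Real.cos θ, Real.sin θ]

/-- The target region: the closed disc of radius `rT` centred at the origin. -/
def targetRegion (rT : ℝ) : Set Plane := Metric.closedBall 0 rT

/-- The disc bounded by the outer boundary of the target's sensing annulus of width `rhoT`. -/
def sensingDisc (rT rhoT : ℝ) : Set Plane := Metric.closedBall 0 (rhoT + rT)

/-- `x` (on times `t ≥ 0`) is a motion with first-order dynamics `x' = v û(ψ)` starting at `x0`,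
for measurable speed and heading controls `v`, `ψ` with `|v| ≤ vmax`. -/
def IsTrajectory (vmax : ℝ) (x0 : Plane) (x : ℝ → Plane) : Prop :=
  ∃ v ψ : ℝ → ℝ, Measurable v ∧ Measurable ψ ∧ (∀ t, 0 ≤ t → |v t| ≤ vmax) ∧
    ∀ t, 0 ≤ t → x t = x0 + ∫ τ in (0 : ℝ)..t, v τ • unitVec (ψ τ)

/-- A strategy of the defender (speed limit `1`, initial position `xD0`) against an intruder
(speed limit `ν`, initial position `xA0`): it answers every intruder motion by a defender motion,
and it is nonanticipative, i.e. the defender's motion up to time `t` depends only on the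
positions of the intruder up to time `t`. -/
def IsDefenderStrategy (ν : ℝ) (xA0 xD0 : Plane) (δ : (ℝ → Plane) → (ℝ → Plane)) : Prop :=
  (∀ xA, IsTrajectory ν xA0 xA → IsTrajectory 1 xD0 (δ xA)) ∧
  (∀ xA xA', IsTrajectory ν xA0 xA → IsTrajectory ν xA0 xA' →
    ∀ t, 0 ≤ t → EqOn xA xA' (Icc 0 t) → EqOn (δ xA) (δ xA') (Icc 0 t))

/-- The intruder is captured at time `T` (the two positions coincide), and it has not
been in the target before. -/
def CapturedAt (rT : ℝ) (xA xD : ℝ → Plane) (T : ℝ) : Prop :=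
  0 ≤ T ∧ xA T = xD T ∧ ∀ t ∈ Ico 0 T, xA t ∉ targetRegion rT

/-- An intruder with sensing radius `rhoA` that has arrived at distance `R` from the target center
in direction `θ` moves radially towards the center with full speed `ν` until it senses
the defender; from then on nothing is prescribed. -/
def RadialUntilSensing (rhoA ν R θ : ℝ) (xA xD : ℝ → Plane) : Prop :=
  ∀ t, 0 ≤ t → (∀ s ∈ Ico 0 t, rhoA < dist (xA s) (xD s)) → xA t = (R - ν * t) • unitVec θ

/-- The defender at `xD0` has a strategy that captures, before it breaches the target,
every intruder arriving at `xA0`, however it moves. -/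
def CanCapture (rT ν : ℝ) (xA0 xD0 : Plane) : Prop :=
  ∃ δ, IsDefenderStrategy ν xA0 xD0 δ ∧
    ∀ xA, IsTrajectory ν xA0 xA → ∃ T, CapturedAt rT xA (δ xA) T

/-- The defender at `xD0` has a strategy that captures every intruder which arrives in direction
`θA` and moves radially until it senses the defender, before it breaches the target
and before it leaves the sensing region of the target. -/
def CanCaptureInside (rT rhoT rhoA ν θA : ℝ) (xD0 : Plane) : Prop :=
  ∃ δ, IsDefenderStrategy ν ((rhoT + rT) • unitVec θA) xD0 δ ∧
    ∀ xA, IsTrajectory ν ((rhoT + rT) • unitVec θA) xA →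
      RadialUntilSensing rhoA ν (rhoT + rT) θA xA (δ xA) →
      ∃ T, CapturedAt rT xA (δ xA) T ∧ ∀ t ∈ Icc 0 T, xA t ∈ sensingDisc rT rhoT

/-- The radicand in the guarding angle. -/
def guardRadicand (rT rhoT ν r : ℝ) : ℝ :=
  (((rT + ν * r) ^ 2 - ((rhoT + rT) - ν * rT) ^ 2) *
      (((rhoT + rT) + ν * rT) ^ 2 - (ν * r - rT) ^ 2)) /
    (16 * ν ^ 2 * rT ^ 2 * r * (rhoT + rT))

/-- The guarding angle `Θ_g`. -/
def guardAngle (rT rhoT ν r : ℝ) : ℝ :=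
  2 * Real.arccos (Real.sqrt (guardRadicand rT rhoT ν r))

end

/-! In parallel pursuit the defender moves at speed 1 so that the line of sight keeps its direction
while the separation shrinks. Until capture this confines the intruder to the initial Apollonius
disc `‖x - xA‖ ≤ ν ‖x - xD‖`, with center `(xA - ν² xD) / (1 - ν²)` and radius `ν ‖xA - xD‖ / (1 -
ν²)`, and to its interior before capture (`exists_capture_pursuit`). The angle `guardAngle` is where
this disc becomes tangent to the target; within the guarding condition the open disc misses the
target (`apollonius_outside_target`), which gives (a).

For (b) the intruder's path is known until it senses the defender. The defender first shrinks the
separation, in a fixed direction, to some `d > rhoA` for which the Apollonius disc fits between the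
target and the outer circle (`exists_constant_velocity`), and then pursues in parallel. -/

/-! ### Unit vectors and measurable polar coordinates -/

theorem norm_unitVec (θ : ℝ) : ‖unitVec θ‖ = 1 := by
  simp [unitVec, EuclideanSpace.norm_eq]

theorem measurable_unitVec : Measurable unitVec := by
  unfold unitVec
  fun_prop

theorem inner_unitVec (α β : ℝ) : inner ℝ (unitVec α) (unitVec β) = Real.cos (α - β) := by
  simp [unitVec, PiLp.inner_apply, Fin.sum_univ_two, Real.cos_sub]
  ring

theorem exists_measurable_polar {V : ℝ → Plane} (hV : Measurable V) :
    ∃ ψ : ℝ → ℝ, Measurable ψ ∧ ∀ t, V t = ‖V t‖ • unitVec (ψ t) := by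
  have hc : ∀ i, Measurable fun t => V t i := fun i => by fun_prop
  refine ⟨fun t => Complex.arg ⟨V t 0, V t 1⟩, ?_, fun t => ?_⟩
  · refine Complex.measurable_arg.comp ?_
    exact measurable_of_re_im (hc 0) (hc 1)
  · have hn : ‖V t‖ = ‖(⟨V t 0, V t 1⟩ : ℂ)‖ := by
      rw [EuclideanSpace.norm_eq, Complex.norm_eq_sqrt_sq_add_sq]
      simp [Fin.sum_univ_two]
    ext i
    fin_cases i
    · simp [unitVec, hn, Complex.norm_mul_cos_arg]
    · simp [unitVec, hn, Complex.norm_mul_sin_arg]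

theorem isTrajectory_of_velocity {vmax : ℝ} {x0 : Plane} {V x : ℝ → Plane} (hV : Measurable V)
    (hb : ∀ t, ‖V t‖ ≤ vmax) (hx : ∀ t, 0 ≤ t → x t = x0 + ∫ τ in (0 : ℝ)..t, V τ) :
    IsTrajectory vmax x0 x := by
  obtain ⟨ψ, hψ, h⟩ := exists_measurable_polar hV
  refine ⟨fun t => ‖V t‖, ψ, hV.norm, hψ, fun t _ => by simpa using hb t, fun t ht => ?_⟩
  rw [hx t ht]
  simp only [← h]

/-! ### Recovering velocities from positions -/

theorem intervalIntegrable_of_measurable_of_bound {E : Type*} [NormedAddCommGroup E]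
    [MeasurableSpace E] [BorelSpace E] [SecondCountableTopology E]
    {f : ℝ → E} {C : ℝ} (hf : Measurable f) (hC : ∀ t, ‖f t‖ ≤ C) (a b : ℝ) :
    IntervalIntegrable f volume a b :=
  (intervalIntegrable_const (c := C)).mono_fun hf.aestronglyMeasurable
    (Filter.Eventually.of_forall fun t => (hC t).trans (le_abs_self C))

/-- The velocity of the motion `x` at positive times where it exists and respects the speed
limit `ν`, and `0` elsewhere. -/
noncomputable def boundedVelocity (ν : ℝ) (x : ℝ → Plane) (t : ℝ) : Plane :=
  open Classical in if 0 < t ∧ ‖deriv x t‖ ≤ ν then deriv x t else 0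

theorem measurable_boundedVelocity (ν : ℝ) (x : ℝ → Plane) : Measurable (boundedVelocity ν x) := by
  have h : Measurable (deriv x) := measurable_deriv x
  refine Measurable.ite ?_ h measurable_const
  exact (measurableSet_Ioi (a := (0 : ℝ))).inter (measurableSet_le h.norm measurable_const)

theorem norm_boundedVelocity_le {ν : ℝ} (hν : 0 ≤ ν) (x : ℝ → Plane) (t : ℝ) :
    ‖boundedVelocity ν x t‖ ≤ ν := by
  unfold boundedVelocity
  split_ifs with h
  · exact h.2
  · simpa using hν

theorem boundedVelocity_congr {ν T t : ℝ} {x y : ℝ → Plane} (h : EqOn x y (Icc 0 T))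
    (ht : t ∈ Ioo 0 T) : boundedVelocity ν x t = boundedVelocity ν y t := by
  have : deriv x t = deriv y t := Filter.EventuallyEq.deriv_eq
    (Filter.eventually_of_mem (Icc_mem_nhds ht.1 ht.2) fun s hs => h hs)
  simp [boundedVelocity, this]

/-- By Lebesgue differentiation the controls agree almost everywhere with the derivative of the
path. A strategy may therefore react to velocities although it is given positions only. -/
theorem IsTrajectory.ae_boundedVelocity {ν : ℝ} {x0 : Plane} {x : ℝ → Plane}
    (hx : IsTrajectory ν x0 x) (hν : 0 ≤ ν) :
    ∀ t, 0 ≤ t → x t = x0 + ∫ τ in (0 : ℝ)..t, boundedVelocity ν x τ := by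
  obtain ⟨v, ψ, hv, hψ, hb, hx⟩ := hx
  set V : ℝ → Plane := (Ioi (0 : ℝ)).indicator fun t => v t • unitVec (ψ t) with hVdef
  have hV : Measurable V :=
    (hv.smul (measurable_unitVec.comp hψ)).indicator measurableSet_Ioi
  have hVb : ∀ t, ‖V t‖ ≤ ν := by
    intro t
    by_cases ht : t ∈ Ioi (0 : ℝ)
    · rw [hVdef, indicator_of_mem ht, norm_smul, norm_unitVec, mul_one]
      exact hb t (le_of_lt ht)
    · rw [hVdef, indicator_of_notMem ht]
      simpa using hν
  have hxV : ∀ t, 0 ≤ t → x t = x0 + ∫ τ in (0 : ℝ)..t, V τ := by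
    intro t ht
    rw [hx t ht, intervalIntegral.integral_of_le ht, intervalIntegral.integral_of_le ht]
    congr 1
    refine setIntegral_congr_fun measurableSet_Ioc fun s hs => ?_
    rw [hVdef, indicator_of_mem (show s ∈ Ioi (0 : ℝ) from hs.1)]
  have hloc : LocallyIntegrable V volume := by
    refine (locallyIntegrable_const ν).mono hV.aestronglyMeasurable
      (Filter.Eventually.of_forall fun t => (hVb t).trans (le_abs_self ν))
  intro t ht
  rw [hxV t ht]
  congr 1
  refine intervalIntegral.integral_congr_ae ?_
  filter_upwards [LocallyIntegrable.ae_hasDerivAt_integral hloc] with s hs hst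
  rw [uIoc_of_le ht] at hst
  have hd : HasDerivAt x (V s) s := by
    refine ((hs 0).const_add x0).congr_of_eventuallyEq ?_
    exact Filter.eventually_of_mem (Ioi_mem_nhds hst.1) fun τ hτ => hxV τ (le_of_lt hτ)
  rw [boundedVelocity, hd.deriv, if_pos ⟨hst.1, hVb s⟩]

theorem IsTrajectory.eq_add_integral {ν : ℝ} {x0 : Plane} {x : ℝ → Plane}
    (hx : IsTrajectory ν x0 x) (hν : 0 ≤ ν) {a b : ℝ} (ha : 0 ≤ a) (hb : 0 ≤ b) :
    x b = x a + ∫ τ in a..b, boundedVelocity ν x τ := by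
  have hi := intervalIntegrable_of_measurable_of_bound (measurable_boundedVelocity ν x)
    (norm_boundedVelocity_le hν x)
  rw [hx.ae_boundedVelocity hν b hb, hx.ae_boundedVelocity hν a ha, add_assoc,
    intervalIntegral.integral_add_adjacent_intervals (hi _ _) (hi _ _)]

theorem IsTrajectory.continuousOn {ν : ℝ} {x0 : Plane} {x : ℝ → Plane}
    (hx : IsTrajectory ν x0 x) (hν : 0 ≤ ν) : ContinuousOn x (Ici 0) := by
  have hi := intervalIntegrable_of_measurable_of_bound (measurable_boundedVelocity ν x)
    (norm_boundedVelocity_le hν x)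
  refine ContinuousOn.congr
    ((continuous_const.add (intervalIntegral.continuous_primitive hi 0)).continuousOn)
    fun t ht => hx.ae_boundedVelocity hν t ht

/-! ### The Apollonius disc -/

/-- With `a = x - xA` and `v = xA - xD`, the first vector is `x` minus the Apollonius center, scaled
by `1 - ν²` to avoid division. -/
theorem norm_smul_sub_smul_sq {E : Type*} [NormedAddCommGroup E] [InnerProductSpace ℝ E]
    (ν : ℝ) (a v : E) :
    ‖(1 - ν ^ 2) • a - ν ^ 2 • v‖ ^ 2 - (ν * ‖v‖) ^ 2 =
      (1 - ν ^ 2) * (‖a‖ ^ 2 - (ν * ‖a + v‖) ^ 2) := by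
  rw [mul_pow ν ‖a + v‖, norm_add_sq_real, norm_sub_sq_real, inner_smul_right,
    real_inner_smul_left, norm_smul, norm_smul, Real.norm_eq_abs, Real.norm_eq_abs, mul_pow,
    mul_pow, sq_abs, sq_abs]
  ring

/-- Points `a` in the Apollonius disc `‖a‖ ≤ ν ‖a + v‖` in terms of its center and radius. -/
theorem norm_smul_sub_smul_le {E : Type*} [NormedAddCommGroup E] [InnerProductSpace ℝ E]
    {ν : ℝ} (hν0 : 0 ≤ ν) (hν1 : ν ≤ 1) {a v : E} (h : ‖a‖ ≤ ν * ‖a + v‖) :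
    ‖(1 - ν ^ 2) • a - ν ^ 2 • v‖ ≤ ν * ‖v‖ := by
  refine le_of_sq_le_sq ?_ (by positivity)
  have h1 := norm_smul_sub_smul_sq ν a v
  have h2 : ‖a‖ ^ 2 ≤ (ν * ‖a + v‖) ^ 2 := pow_le_pow_left₀ (norm_nonneg a) h 2
  have h3 : 0 ≤ 1 - ν ^ 2 := by nlinarith
  nlinarith

theorem norm_smul_sub_smul_lt {E : Type*} [NormedAddCommGroup E] [InnerProductSpace ℝ E]
    {ν : ℝ} (hν0 : 0 ≤ ν) (hν1 : ν < 1) {a v : E} (h : ‖a‖ < ν * ‖a + v‖) :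
    ‖(1 - ν ^ 2) • a - ν ^ 2 • v‖ < ν * ‖v‖ := by
  refine lt_of_pow_lt_pow_left₀ 2 (by positivity) ?_
  have h1 := norm_smul_sub_smul_sq ν a v
  have h2 : ‖a‖ ^ 2 < (ν * ‖a + v‖) ^ 2 := pow_lt_pow_left₀ h (norm_nonneg a) two_ne_zero
  have h3 : 0 < 1 - ν ^ 2 := by nlinarith
  nlinarith

/-! ### Parallel pursuit -/

/-- The speed `l` along the unit vector `e` for which `w + l e` is a unit vector. -/
noncomputable def closingSpeed (e w : Plane) : ℝ :=
  -inner ℝ w e + Real.sqrt (1 - ‖w‖ ^ 2 + inner ℝ w e ^ 2)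

theorem measurable_closingSpeed (e : Plane) : Measurable (closingSpeed e) := by
  unfold closingSpeed
  fun_prop

section ClosingSpeed

variable {e w : Plane} {ν : ℝ}

theorem norm_add_closingSpeed_smul (he : ‖e‖ = 1) (hw : ‖w‖ ≤ ν) (hν : ν < 1) :
    ‖w + closingSpeed e w • e‖ = 1 := by
  have h0 : 0 ≤ 1 - ‖w‖ ^ 2 + inner ℝ w e ^ 2 := by
    nlinarith [norm_nonneg w, sq_nonneg (inner ℝ w e)]
  have h := Real.sq_sqrt h0
  have : ‖w + closingSpeed e w • e‖ ^ 2 = 1 := by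
    rw [norm_add_sq_real, inner_smul_right, norm_smul, he, mul_one, Real.norm_eq_abs, sq_abs]
    unfold closingSpeed
    nlinarith
  nlinarith [norm_nonneg (w + closingSpeed e w • e)]

theorem one_sub_le_closingSpeed (he : ‖e‖ = 1) (hw : ‖w‖ ≤ ν) (hν : ν < 1) :
    1 - ν ≤ closingSpeed e w := by
  have hi : |inner ℝ w e| ≤ ‖w‖ := by simpa [he] using abs_real_inner_le_norm w e
  rw [abs_le] at hi
  have hn := norm_nonneg w
  have : 1 - ‖w‖ + inner ℝ w e ≤ Real.sqrt (1 - ‖w‖ ^ 2 + inner ℝ w e ^ 2) := by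
    refine Real.le_sqrt_of_sq_le ?_
    nlinarith
  unfold closingSpeed
  linarith

theorem abs_closingSpeed_le (he : ‖e‖ = 1) (hw : ‖w‖ ≤ ν) (hν : ν < 1) :
    |closingSpeed e w| ≤ 2 := by
  have h1 : ‖closingSpeed e w • e‖ ≤ ‖w + closingSpeed e w • e‖ + ‖w‖ := by
    simpa using norm_sub_le (w + closingSpeed e w • e) w
  rw [norm_add_closingSpeed_smul he hw hν, norm_smul, he, mul_one, Real.norm_eq_abs] at h1
  linarith

/-- Infinitesimal confinement: `‖w‖ ≤ ν = ν ‖w + l e‖` puts `w` in the Apollonius disc of the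
separation `l e`. Integrating over time gives the global bound. -/
theorem norm_sub_closingSpeed_smul_le (he : ‖e‖ = 1) (hw : ‖w‖ ≤ ν) (hν0 : 0 ≤ ν) (hν : ν < 1) :
    ‖(1 - ν ^ 2) • w - (ν ^ 2 * closingSpeed e w) • e‖ ≤ ν * closingSpeed e w := by
  have hl : ‖closingSpeed e w • e‖ = closingSpeed e w := by
    rw [norm_smul, he, mul_one, Real.norm_eq_abs, abs_of_nonneg]
    linarith [one_sub_le_closingSpeed he hw hν]
  have h := norm_smul_sub_smul_le hν0 hν.le (a := w) (v := closingSpeed e w • e)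
    (by rwa [norm_add_closingSpeed_smul he hw hν, mul_one])
  rwa [hl, smul_smul] at h

end ClosingSpeed

/-- The velocity of a defender who moves with constant velocity `u` up to time `t1`, then keeps
its bearing to the intruder while it closes the distance `d` at full speed in direction `e`,
and then copies the velocity of the intruder. -/
noncomputable def pursuitVelocity (ν t1 : ℝ) (u e : Plane) (d : ℝ) (x : ℝ → Plane) (t : ℝ) : Plane :=
  open Classical in
  if t < t1 then u else boundedVelocity ν x t +
    if ∫ s in t1..t, closingSpeed e (boundedVelocity ν x s) < d then
      closingSpeed e (boundedVelocity ν x t) • e else 0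

/-- The defender strategy with velocity `pursuitVelocity`. -/
noncomputable def pursuit (ν t1 : ℝ) (u e : Plane) (d : ℝ) (xD0 : Plane) (x : ℝ → Plane) (t : ℝ) :
    Plane :=
  xD0 + ∫ s in (0 : ℝ)..t, pursuitVelocity ν t1 u e d x s

section Pursuit

variable {ν t1 d : ℝ} {u e xA0 xD0 : Plane}

theorem measurable_closingSpeed_boundedVelocity (ν : ℝ) (e : Plane) (x : ℝ → Plane) :
    Measurable fun t => closingSpeed e (boundedVelocity ν x t) :=
  (measurable_closingSpeed e).comp (measurable_boundedVelocity ν x)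

theorem intervalIntegrable_closingSpeed (hν0 : 0 ≤ ν) (hν1 : ν < 1) (he : ‖e‖ = 1)
    (x : ℝ → Plane) (a b : ℝ) :
    IntervalIntegrable (fun t => closingSpeed e (boundedVelocity ν x t)) volume a b :=
  intervalIntegrable_of_measurable_of_bound (measurable_closingSpeed_boundedVelocity ν e x)
    (fun t => abs_closingSpeed_le he (norm_boundedVelocity_le hν0 x t) hν1) a b

theorem continuous_integral_closingSpeed (hν0 : 0 ≤ ν) (hν1 : ν < 1) (he : ‖e‖ = 1)
    (x : ℝ → Plane) (a : ℝ) :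
    Continuous fun t => ∫ s in a..t, closingSpeed e (boundedVelocity ν x s) :=
  intervalIntegral.continuous_primitive (intervalIntegrable_closingSpeed hν0 hν1 he x) a

theorem integral_closingSpeed_ge (hν0 : 0 ≤ ν) (hν1 : ν < 1) (he : ‖e‖ = 1)
    (x : ℝ → Plane) {a b : ℝ} (hab : a ≤ b) :
    (1 - ν) * (b - a) ≤ ∫ s in a..b, closingSpeed e (boundedVelocity ν x s) := by
  have := intervalIntegral.integral_mono_on (μ := volume) hab
    (intervalIntegrable_const (c := 1 - ν))
    (intervalIntegrable_closingSpeed hν0 hν1 he x a b)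
    fun t _ => one_sub_le_closingSpeed he (norm_boundedVelocity_le hν0 x t) hν1
  rwa [intervalIntegral.integral_const, smul_eq_mul, mul_comm] at this

theorem measurable_pursuitVelocity (hν0 : 0 ≤ ν) (hν1 : ν < 1) (he : ‖e‖ = 1) (x : ℝ → Plane) :
    Measurable (pursuitVelocity ν t1 u e d x) := by
  refine Measurable.ite measurableSet_Iio measurable_const
    ((measurable_boundedVelocity ν x).add (Measurable.ite ?_ ?_ measurable_const))
  · exact measurableSet_lt (continuous_integral_closingSpeed hν0 hν1 he x t1).measurable
      measurable_const
  · exact (measurable_closingSpeed_boundedVelocity ν e x).smul_const e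

theorem norm_pursuitVelocity_le (hν0 : 0 ≤ ν) (hν1 : ν < 1) (he : ‖e‖ = 1) (hu : ‖u‖ ≤ 1)
    (x : ℝ → Plane) (t : ℝ) : ‖pursuitVelocity ν t1 u e d x t‖ ≤ 1 := by
  have h := norm_boundedVelocity_le hν0 x t
  unfold pursuitVelocity
  split_ifs
  · exact hu
  · exact (norm_add_closingSpeed_smul he h hν1).le
  · rw [add_zero]
    linarith

theorem isDefenderStrategy_pursuit (hν0 : 0 ≤ ν) (hν1 : ν < 1) (he : ‖e‖ = 1) (hu : ‖u‖ ≤ 1)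
    (ht1 : 0 ≤ t1) : IsDefenderStrategy ν xA0 xD0 (pursuit ν t1 u e d xD0) := by
  refine ⟨fun x _ => isTrajectory_of_velocity (measurable_pursuitVelocity hν0 hν1 he x)
    (norm_pursuitVelocity_le hν0 hν1 he hu x) fun t _ => rfl, ?_⟩
  intro x y _ _ t _ hxy s hs
  unfold pursuit
  congr 1
  refine intervalIntegral.integral_congr_ae ?_
  -- The endpoint is discarded because a two-sided derivative there could depend on later positions.
  filter_upwards [compl_mem_ae_iff.2 (measure_singleton s)] with τ hτs hτ
  rw [uIoc_of_le hs.1] at hτ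
  have hτ' : τ ∈ Ioo 0 t := ⟨hτ.1, (lt_of_le_of_ne hτ.2 hτs).trans_le hs.2⟩
  unfold pursuitVelocity
  by_cases h1 : τ < t1
  · simp [h1]
  have h2 : ∫ s in t1..τ, closingSpeed e (boundedVelocity ν x s) =
      ∫ s in t1..τ, closingSpeed e (boundedVelocity ν y s) := by
    refine intervalIntegral.integral_congr_ae (Filter.Eventually.of_forall fun a ha => ?_)
    rw [uIoc_of_le (not_lt.1 h1)] at ha
    simp only [boundedVelocity_congr hxy ⟨ht1.trans_lt ha.1, ha.2.trans_lt hτ'.2⟩]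
  rw [h2, boundedVelocity_congr hxy hτ']

theorem pursuit_of_le (x : ℝ → Plane) {t : ℝ} (ht0 : 0 ≤ t) (ht : t ≤ t1) :
    pursuit ν t1 u e d xD0 x t = xD0 + t • u := by
  unfold pursuit
  congr 1
  trans ∫ s in (0 : ℝ)..t, u
  · refine intervalIntegral.integral_congr_ae ?_
    filter_upwards [compl_mem_ae_iff.2 (measure_singleton t)] with τ hτs hτ
    rw [uIoc_of_le ht0] at hτ
    simp [pursuitVelocity, (lt_of_le_of_ne hτ.2 hτs).trans_le ht]
  · simp

theorem pursuit_eq_add_smul (hν0 : 0 ≤ ν) (hν1 : ν < 1) (he : ‖e‖ = 1) (hu : ‖u‖ ≤ 1)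
    (ht1 : 0 ≤ t1) {x : ℝ → Plane} (hx : IsTrajectory ν xA0 x) {t : ℝ} (ht : t1 ≤ t)
    (hd : ∫ s in t1..t, closingSpeed e (boundedVelocity ν x s) ≤ d) :
    pursuit ν t1 u e d xD0 x t = xD0 + t1 • u + (x t - x t1) +
      (∫ s in t1..t, closingSpeed e (boundedVelocity ν x s)) • e := by
  have hi := intervalIntegrable_of_measurable_of_bound
    (measurable_pursuitVelocity (t1 := t1) (u := u) (d := d) hν0 hν1 he x)
    (norm_pursuitVelocity_le hν0 hν1 he hu x)
  have hi' := intervalIntegrable_of_measurable_of_bound (measurable_boundedVelocity ν x)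
    (norm_boundedVelocity_le hν0 x)
  have h1 : pursuit ν t1 u e d xD0 x t = pursuit ν t1 u e d xD0 x t1 +
      ∫ s in t1..t, pursuitVelocity ν t1 u e d x s := by
    unfold pursuit
    rw [add_assoc, intervalIntegral.integral_add_adjacent_intervals (hi _ _) (hi _ _)]
  rw [h1, pursuit_of_le x ht1 le_rfl,
    hx.eq_add_integral hν0 ht1 (ht1.trans ht), add_sub_cancel_left, add_assoc _ (∫ _ in t1..t, _)]
  congr 1
  rw [← intervalIntegral.integral_smul_const, ← intervalIntegral.integral_add (hi' _ _)
    ⟨(intervalIntegrable_closingSpeed hν0 hν1 he x t1 t).1.smul_const e,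
      (intervalIntegrable_closingSpeed hν0 hν1 he x t1 t).2.smul_const e⟩]
  refine intervalIntegral.integral_congr_ae ?_
  filter_upwards [compl_mem_ae_iff.2 (measure_singleton t)] with τ hτs hτ
  rw [uIoc_of_le ht] at hτ
  have hτt : τ < t := lt_of_le_of_ne hτ.2 hτs
  -- The closed distance increases strictly, so the closing term is still switched on before `t`.
  have hlt : ∫ s in t1..τ, closingSpeed e (boundedVelocity ν x s) < d := by
    refine lt_of_lt_of_le ?_ hd
    have h2 := integral_closingSpeed_ge hν0 hν1 he x hτt.le
    have h3 := intervalIntegral.integral_add_adjacent_intervals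
      (intervalIntegrable_closingSpeed hν0 hν1 he x t1 τ)
      (intervalIntegrable_closingSpeed hν0 hν1 he x τ t)
    have : 0 < (1 - ν) * (t - τ) := mul_pos (by linarith) (by linarith)
    linarith
  simp [pursuitVelocity, not_lt.2 hτ.1.le, hlt]

/-- Parallel pursuit captures, and until then the intruder stays in the Apollonius disc. -/
theorem exists_capture_pursuit (hν0 : 0 < ν) (hν1 : ν < 1) (he : ‖e‖ = 1) (hu : ‖u‖ ≤ 1)
    (ht1 : 0 ≤ t1) (hd : 0 ≤ d) {x : ℝ → Plane} (hx : IsTrajectory ν xA0 x)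
    (hrel : x t1 - (xD0 + t1 • u) = d • e) :
    ∃ T, t1 ≤ T ∧ x T = pursuit ν t1 u e d xD0 x T ∧
      (∀ t ∈ Icc t1 T, ‖(1 - ν ^ 2) • x t - (x t1 - ν ^ 2 • (xD0 + t1 • u))‖ ≤ ν * d) ∧
      ∀ t ∈ Ico t1 T, ‖(1 - ν ^ 2) • x t - (x t1 - ν ^ 2 • (xD0 + t1 • u))‖ < ν * d := by
  have hν0' := hν0.le
  set L : ℝ → ℝ := fun t => ∫ s in t1..t, closingSpeed e (boundedVelocity ν x s) with hL
  have hLc : Continuous L := continuous_integral_closingSpeed hν0' hν1 he x t1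
  have hν1' : 0 < 1 - ν := by linarith
  have hLm : ∀ a b, a ≤ b → (1 - ν) * (b - a) ≤ L b - L a := by
    intro a b hab
    have h2 := integral_closingSpeed_ge hν0' hν1 he x hab
    have h3 := intervalIntegral.integral_add_adjacent_intervals
      (intervalIntegrable_closingSpeed hν0' hν1 he x t1 a)
      (intervalIntegrable_closingSpeed hν0' hν1 he x a b)
    simp only [hL]
    linarith
  have hL1 : L t1 = 0 := intervalIntegral.integral_same
  have hle : t1 ≤ t1 + d / (1 - ν) := by
    have : 0 ≤ d / (1 - ν) := by positivity
    linarith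
  obtain ⟨T, hT, hLT⟩ : d ∈ L '' Icc t1 (t1 + d / (1 - ν)) := by
    refine intermediate_value_Icc hle hLc.continuousOn ⟨by rw [hL1]; exact hd, ?_⟩
    have := hLm _ _ hle
    rw [hL1, add_sub_cancel_left, mul_div_cancel₀ _ hν1'.ne'] at this
    linarith
  -- The motion so far contributes `ν L`, the remaining separation `ν² (d - L)`. As `ν² < ν`, the
  -- sum is at most `ν d` when `L ≤ d`, strictly so when `L < d`.
  have key : ∀ t, t1 ≤ t →
      ‖(1 - ν ^ 2) • x t - (x t1 - ν ^ 2 • (xD0 + t1 • u))‖ ≤ ν * L t + ν ^ 2 * |d - L t| := by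
    intro t ht
    have hi' := intervalIntegrable_of_measurable_of_bound (measurable_boundedVelocity ν x)
      (norm_boundedVelocity_le hν0' x) t1 t
    have hi := intervalIntegrable_closingSpeed hν0' hν1 he x t1 t
    have h1 : (1 - ν ^ 2) • (x t - x t1) - (ν ^ 2 * L t) • e = ∫ s in t1..t,
        ((1 - ν ^ 2) • boundedVelocity ν x s -
          (ν ^ 2 * closingSpeed e (boundedVelocity ν x s)) • e) := by
      have hA : IntervalIntegrable (fun s => (1 - ν ^ 2) • boundedVelocity ν x s) volume t1 t :=
        hi'.smul (1 - ν ^ 2)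
      have hB : IntervalIntegrable
          (fun s => (ν ^ 2 * closingSpeed e (boundedVelocity ν x s)) • e) volume t1 t :=
        ⟨(hi.const_mul _).1.smul_const e, (hi.const_mul _).2.smul_const e⟩
      rw [intervalIntegral.integral_sub hA hB,
        intervalIntegral.integral_smul, intervalIntegral.integral_smul_const,
        intervalIntegral.integral_const_mul, hx.eq_add_integral hν0' ht1 (ht1.trans ht),
        add_sub_cancel_left]
    have h2 : ‖(1 - ν ^ 2) • (x t - x t1) - (ν ^ 2 * L t) • e‖ ≤ ν * L t := by
      rw [h1, hL, ← intervalIntegral.integral_const_mul]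
      refine intervalIntegral.norm_integral_le_of_norm_le ht
        (Filter.Eventually.of_forall fun s _ => ?_) (hi.const_mul _)
      exact norm_sub_closingSpeed_smul_le he (norm_boundedVelocity_le hν0' x s) hν0' hν1
    have h3 : (1 - ν ^ 2) • x t - (x t1 - ν ^ 2 • (xD0 + t1 • u)) =
        ((1 - ν ^ 2) • (x t - x t1) - (ν ^ 2 * L t) • e) - (ν ^ 2 * (d - L t)) • e := by
      rw [← sub_eq_zero]
      have : xD0 + t1 • u = x t1 - d • e := by rw [← hrel]; abel
      rw [this]
      module
    rw [h3]
    refine (norm_sub_le _ _).trans (add_le_add h2 ?_)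
    rw [norm_smul, he, mul_one, Real.norm_eq_abs, abs_mul, abs_of_nonneg (sq_nonneg ν)]
  refine ⟨T, hT.1, ?_, fun t ht => ?_, fun t ht => ?_⟩
  · rw [pursuit_eq_add_smul hν0' hν1 he hu ht1 hx hT.1 hLT.le]
    change x T = _ + L T • e
    rw [hLT, ← hrel]
    abel
  · have h1 := hLm t T ht.2
    have h2 : 0 ≤ (1 - ν) * (T - t) := mul_nonneg hν1'.le (by linarith [ht.2])
    refine (key t ht.1).trans ?_
    rw [abs_of_nonneg (by linarith)]
    nlinarith [mul_nonneg hν0.le hν1'.le]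
  · have h1 := hLm t T ht.2.le
    have h2 : 0 < (1 - ν) * (T - t) := mul_pos hν1' (by linarith [ht.2])
    refine (key t ht.1).trans_lt ?_
    rw [abs_of_nonneg (by linarith)]
    nlinarith [mul_pos hν0 hν1']

end Pursuit

/-! ### The guarding angle -/

theorem norm_smul_unitVec_sub_sq (R r α β : ℝ) :
    ‖R • unitVec α - r • unitVec β‖ ^ 2 = R ^ 2 + r ^ 2 - 2 * R * r * Real.cos (α - β) := by
  rw [norm_sub_sq_real, real_inner_smul_left, inner_smul_right, inner_unitVec, norm_smul, norm_smul,
    norm_unitVec, norm_unitVec, mul_one, mul_one, Real.norm_eq_abs, Real.norm_eq_abs, sq_abs, sq_abs]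
  ring

theorem guardRadicand_mem_Icc {rT rhoT ν r : ℝ} (hrT : 0 < rT) (hν0 : 0 < ν) (hν1 : ν < 1)
    (hrho : ν * rT ≤ rhoT) (hr : r ≤ rhoT + rT) (hr' : rhoT / ν - rT < r) :
    guardRadicand rT rhoT ν r ∈ Icc (0 : ℝ) 1 := by
  have h1 : rhoT < ν * (r + rT) := by
    rw [mul_comm]
    exact (div_lt_iff₀ hν0).1 (by linarith)
  have hr0 : 0 < r := by nlinarith
  have hrho0 : 0 < rhoT := lt_of_lt_of_le (by positivity) hrho
  have hνr : ν * r < r := by nlinarith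
  have hνT : ν * rT < rT := by nlinarith
  have hden : 0 < 16 * ν ^ 2 * rT ^ 2 * r * (rhoT + rT) := by positivity
  have hνr0 : 0 < ν * r := by positivity
  have hνT0 : 0 < ν * rT := by positivity
  have ha : 0 ≤ (rT + ν * r) ^ 2 - ((rhoT + rT) - ν * rT) ^ 2 := by
    have : 0 ≤ (rT + ν * r - (rhoT + rT - ν * rT)) * (rT + ν * r + (rhoT + rT - ν * rT)) :=
      mul_nonneg (by linarith) (by linarith)
    linarith
  have hb : 0 ≤ ((rhoT + rT) + ν * rT) ^ 2 - (ν * r - rT) ^ 2 := by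
    have : 0 ≤ (rhoT + rT + ν * rT - (ν * r - rT)) * (rhoT + rT + ν * rT + (ν * r - rT)) :=
      mul_nonneg (by linarith) (by linarith)
    linarith
  refine ⟨div_nonneg (mul_nonneg ha hb) hden.le, (div_le_one hden).2 ?_⟩
  set R := rhoT + rT with hR
  -- With `F = R² - ν² r² - (1 - ν²) rT²` the numerator is `(2 ν rT (R + r))² - F²`, so the bound by
  -- 1 amounts to `(2 ν rT (R - r))² ≤ F²`. The difference here is `F - 2 ν rT (R - r)`.
  have hc : 0 ≤ (R - ν * rT) ^ 2 - (ν * r - rT) ^ 2 := by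
    have : 0 ≤ (R - ν * rT - (ν * r - rT)) * (R - ν * rT + (ν * r - rT)) :=
      mul_nonneg (by linarith) (by linarith)
    linarith
  have he : 0 ≤ (R ^ 2 - ν ^ 2 * r ^ 2 - (1 - ν ^ 2) * rT ^ 2) - 2 * ν * rT * (R - r) := by linarith
  have hf : 0 ≤ 2 * ν * rT * (R - r) := mul_nonneg (by positivity) (by linarith)
  have hg : (2 * ν * rT * (R - r)) ^ 2 ≤ (R ^ 2 - ν ^ 2 * r ^ 2 - (1 - ν ^ 2) * rT ^ 2) ^ 2 :=
    pow_le_pow_left₀ hf (by linarith) 2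
  linarith

theorem guardRadicand_le_cos_half_sq {rT rhoT ν r φ : ℝ}
    (hmem : guardRadicand rT rhoT ν r ∈ Icc (0 : ℝ) 1) (hφ : |φ| ≤ guardAngle rT rhoT ν r) :
    guardRadicand rT rhoT ν r ≤ Real.cos (φ / 2) ^ 2 := by
  have h1 : |φ / 2| ≤ Real.arccos (Real.sqrt (guardRadicand rT rhoT ν r)) := by
    rw [abs_div, abs_two]
    unfold guardAngle at hφ
    linarith
  have h2 := Real.cos_le_cos_of_nonneg_of_le_pi (abs_nonneg _) (Real.arccos_le_pi _) h1
  rw [Real.cos_abs, Real.cos_arccos (by linarith [Real.sqrt_nonneg (guardRadicand rT rhoT ν r)])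
    (Real.sqrt_le_one.2 hmem.2)] at h2
  calc _ = Real.sqrt (guardRadicand rT rhoT ν r) ^ 2 := (Real.sq_sqrt hmem.1).symm
    _ ≤ _ := pow_le_pow_left₀ (Real.sqrt_nonneg _) h2 2

/-- Under the guarding condition the Apollonius disc does not meet the open target. -/
theorem apollonius_outside_target {rT rhoT ν r θA θD : ℝ} (hrT : 0 < rT) (hν0 : 0 < ν)
    (hν1 : ν < 1) (hrho : ν * rT ≤ rhoT) (hr0 : 0 ≤ r) (hr : r ≤ rhoT + rT)
    (hθ : |θA - θD| ≤ if rhoT / ν - rT < r then guardAngle rT rhoT ν r else Real.pi) :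
    (1 - ν ^ 2) * rT + ν * ‖(rhoT + rT) • unitVec θA - r • unitVec θD‖ ≤
      ‖(rhoT + rT) • unitVec θA - ν ^ 2 • r • unitVec θD‖ := by
  have hrho0 : 0 < rhoT := lt_of_lt_of_le (by positivity) hrho
  have hd2 := norm_smul_unitVec_sub_sq (rhoT + rT) r θA θD
  have hG2 := norm_smul_unitVec_sub_sq (rhoT + rT) (ν ^ 2 * r) θA θD
  rw [mul_smul] at hG2
  set d := ‖(rhoT + rT) • unitVec θA - r • unitVec θD‖
  set G := ‖(rhoT + rT) • unitVec θA - ν ^ 2 • r • unitVec θD‖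
  have hd0 : 0 ≤ d := norm_nonneg _
  set R := rhoT + rT with hR
  have hν2 : 0 < 1 - ν ^ 2 := by nlinarith
  have hR0 : 0 < R := by linarith
  have hcos : Real.cos (θA - θD) = 2 * Real.cos ((θA - θD) / 2) ^ 2 - 1 := by
    rw [← Real.cos_two_mul]
    congr 1
    ring
  set c := Real.cos ((θA - θD) / 2) ^ 2 with hc
  have hc0 : 0 ≤ c := sq_nonneg _
  have hF0 : 0 ≤ R ^ 2 - ν ^ 2 * r ^ 2 - (1 - ν ^ 2) * rT ^ 2 := by
    have h1 : r ^ 2 ≤ R ^ 2 := pow_le_pow_left₀ hr0 hr 2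
    have h2 : rT ^ 2 ≤ R ^ 2 := pow_le_pow_left₀ hrT.le (by linarith) 2
    nlinarith [mul_nonneg (sq_nonneg ν) (sub_nonneg.2 h1), mul_nonneg hν2.le (sub_nonneg.2 h2)]
  -- This is the squared goal after cancelling `ν² d²` and a factor `1 - ν²`. Since `d² = (R + r)² -
  -- 4 R r c`, its own square says that the radicand is at most `c`.
  have hF : 2 * ν * rT * d ≤ R ^ 2 - ν ^ 2 * r ^ 2 - (1 - ν ^ 2) * rT ^ 2 := by
    refine le_of_sq_le_sq ?_ hF0
    split_ifs at hθ with hcase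
    · have hmem := guardRadicand_mem_Icc hrT hν0 hν1 hrho hr hcase
      have h1 := guardRadicand_le_cos_half_sq hmem hθ
      have hr1 : 0 < r := by
        have : rT ≤ rhoT / ν := (le_div_iff₀ hν0).2 (by linarith)
        linarith
      unfold guardRadicand at h1
      rw [← hc, ← hR, div_le_iff₀ (by positivity)] at h1
      rw [mul_pow, hd2, hcos]
      linarith
    -- Here even the worst case of opposite directions, `d = R + r`, is harmless.
    · have h1 : ν * (r + rT) ≤ rhoT := by
        have := (le_div_iff₀ hν0).1 (show r + rT ≤ rhoT / ν by linarith)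
        linarith
      have h2 : (rT + ν * r) ^ 2 ≤ (R - ν * rT) ^ 2 :=
        pow_le_pow_left₀ (by positivity) (by linarith) 2
      have h3 : d ^ 2 ≤ (R + r) ^ 2 := by
        rw [hd2, hcos]
        nlinarith [mul_nonneg (mul_nonneg hR0.le hr0) hc0]
      have h4 : 2 * ν * rT * (R + r) ≤ R ^ 2 - ν ^ 2 * r ^ 2 - (1 - ν ^ 2) * rT ^ 2 := by linarith
      calc (2 * ν * rT * d) ^ 2 = (2 * ν * rT) ^ 2 * d ^ 2 := by ring
        _ ≤ (2 * ν * rT) ^ 2 * (R + r) ^ 2 := by gcongr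
        _ = (2 * ν * rT * (R + r)) ^ 2 := by ring
        _ ≤ _ := pow_le_pow_left₀ (by positivity) h4 2
  refine le_of_sq_le_sq ?_ (norm_nonneg _)
  have hG : G ^ 2 = (1 - ν ^ 2) * (R ^ 2 - ν ^ 2 * r ^ 2) + ν ^ 2 * d ^ 2 := by
    rw [hG2, hd2]
    ring
  rw [hG]
  nlinarith [mul_le_mul_of_nonneg_left hF hν2.le]

/-! ### Capture strategies -/

theorem exists_unit_smul_norm (v : Plane) : ∃ e : Plane, ‖e‖ = 1 ∧ v = ‖v‖ • e := by
  by_cases hv : v = 0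
  · exact ⟨unitVec 0, norm_unitVec 0, by simp [hv]⟩
  · have : ‖v‖ ≠ 0 := norm_ne_zero_iff.2 hv
    exact ⟨‖v‖⁻¹ • v, by simp [norm_smul, this], by simp [smul_smul, this]⟩

theorem exists_smul_eq_of_norm_le {w : Plane} {t : ℝ} (h : ‖w‖ ≤ t) :
    ∃ u : Plane, ‖u‖ ≤ 1 ∧ t • u = w := by
  rcases (norm_nonneg w).trans h |>.eq_or_lt with rfl | ht
  · exact ⟨0, by simp, by simpa using (norm_le_zero_iff.1 h).symm⟩
  · refine ⟨t⁻¹ • w, ?_, by simp [smul_smul, ht.ne']⟩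
    rw [norm_smul, norm_inv, Real.norm_of_nonneg ht.le, inv_mul_le_iff₀ ht, mul_one]
    exact h

theorem notMem_targetRegion_of_norm_lt {rT ν s : ℝ} (hν : 0 ≤ 1 - ν ^ 2) {x G : Plane}
    (hG : (1 - ν ^ 2) * rT + s ≤ ‖G‖) (hx : ‖(1 - ν ^ 2) • x - G‖ < s) : x ∉ targetRegion rT := by
  intro hmem
  rw [targetRegion, mem_closedBall_zero_iff] at hmem
  have h1 := norm_sub_norm_le G ((1 - ν ^ 2) • x)
  rw [norm_sub_rev, norm_smul, Real.norm_of_nonneg hν] at h1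
  nlinarith [mul_le_mul_of_nonneg_left hmem hν]

theorem norm_le_of_norm_smul_sub_le {R ν s : ℝ} (hν : 0 < 1 - ν ^ 2) {x G : Plane}
    (hG : ‖G‖ + s ≤ (1 - ν ^ 2) * R) (hx : ‖(1 - ν ^ 2) • x - G‖ ≤ s) : ‖x‖ ≤ R := by
  have h1 := norm_sub_norm_le ((1 - ν ^ 2) • x) G
  rw [norm_smul, Real.norm_of_nonneg hν.le] at h1
  exact le_of_mul_le_mul_left (by linarith) hν

theorem canCapture_of_apollonius_outside {rT ν : ℝ} {xA0 xD0 : Plane} (hν0 : 0 < ν) (hν1 : ν < 1)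
    (hout : (1 - ν ^ 2) * rT + ν * ‖xA0 - xD0‖ ≤ ‖xA0 - ν ^ 2 • xD0‖) :
    CanCapture rT ν xA0 xD0 := by
  obtain ⟨e, he, hv⟩ := exists_unit_smul_norm (xA0 - xD0)
  refine ⟨pursuit ν 0 0 e ‖xA0 - xD0‖ xD0,
    isDefenderStrategy_pursuit hν0.le hν1 he (by simp) le_rfl, fun x hx => ?_⟩
  have hx0 : x 0 = xA0 := by
    obtain ⟨v, ψ, -, -, -, h⟩ := hx
    simpa using h 0 le_rfl
  obtain ⟨T, hT, hcap, -, hlt⟩ := exists_capture_pursuit hν0 hν1 he (u := 0) (by simp) le_rfl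
    (norm_nonneg _) hx (xD0 := xD0) (by simpa [hx0] using hv)
  refine ⟨T, hT, hcap, fun t ht => ?_⟩
  refine notMem_targetRegion_of_norm_lt (by nlinarith) hout ?_
  simpa [hx0] using hlt t ht

/-- Against a radially moving intruder, the defender can use a constant velocity after which the
distance is `d` and the Apollonius disc lies between the target and the circle of radius `R`. -/
theorem exists_constant_velocity {rT R ν d : ℝ} {a xD0 : Plane} (hrT : 0 < rT) (hν0 : 0 < ν)
    (hν1 : ν < 1) (ha : ‖a‖ = 1) (hR : rT ≤ R)
    (hout : (1 - ν ^ 2) * rT + ν * ‖R • a - xD0‖ ≤ ‖R • a - ν ^ 2 • xD0‖)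
    (hd0 : 0 < d) (hd : d ≤ ‖R • a - xD0‖) (hdR : 2 * ν * d ≤ (1 - ν ^ 2) * (R - rT)) :
    ∃ (t : ℝ) (u : Plane), 0 ≤ t ∧ ν * t ≤ R ∧ ‖u‖ ≤ 1 ∧
      (∀ s ∈ Icc 0 t, d ≤ ‖(R - ν * s) • a - (xD0 + s • u)‖) ∧
      ‖(R - ν * t) • a - (xD0 + t • u)‖ = d ∧
      (1 - ν ^ 2) * rT + ν * d ≤ ‖(R - ν * t) • a - ν ^ 2 • (xD0 + t • u)‖ ∧
      ‖(R - ν * t) • a - ν ^ 2 • (xD0 + t • u)‖ + ν * d ≤ (1 - ν ^ 2) * R := by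
  have hν2 : 0 < 1 - ν ^ 2 := by nlinarith
  obtain ⟨v, hv⟩ : ∃ v, v = R • a - xD0 := ⟨_, rfl⟩
  obtain rfl : xD0 = R • a - v := by rw [hv]; abel
  clear hv
  rw [sub_sub_cancel] at hout hd
  have hvpos : 0 < ‖v‖ := hd0.trans_le hd
  set k := d / ‖v‖ with hk
  have hkv : k * ‖v‖ = d := div_mul_cancel₀ _ hvpos.ne'
  have hk0 : 0 ≤ k := by positivity
  have hk1 : k ≤ 1 := (div_le_one hvpos).2 hd
  -- `T` is the interception time at full speed against radial motion. Were there none by arrival at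
  -- the target, `rT • a` would lie in the open Apollonius disc.
  obtain ⟨T, ⟨hT0, hTR⟩, hT⟩ : ∃ T ∈ Icc 0 ((R - rT) / ν), ‖v - (ν * T) • a‖ - T = 0 := by
    have hm0 : 0 ≤ (R - rT) / ν := div_nonneg (by linarith) hν0.le
    have hcont : Continuous fun T : ℝ => ‖v - (ν * T) • a‖ - T := by fun_prop
    refine intermediate_value_Icc' hm0 hcont.continuousOn ⟨?_, by simp⟩
    by_contra! hlt
    have hνm : ν * ((R - rT) / ν) = R - rT := mul_div_cancel₀ _ hν0.ne'
    rw [sub_pos, hνm] at hlt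
    have h1 : ‖(-(R - rT)) • a‖ < ν * ‖(-(R - rT)) • a + v‖ := by
      rw [norm_smul, ha, mul_one, norm_neg, Real.norm_of_nonneg (by linarith), ← hνm,
        mul_lt_mul_iff_right₀ hν0, hνm, neg_smul, neg_add_eq_sub]
      exact hlt
    have h2 := norm_smul_sub_smul_lt hν0.le hν1 h1
    refine notMem_targetRegion_of_norm_lt (x := rT • a) hν2.le hout ?_ ?_
    · have h3 : (1 - ν ^ 2) • rT • a - (R • a - ν ^ 2 • (R • a - v)) =
          (1 - ν ^ 2) • (-(R - rT)) • a - ν ^ 2 • v := by module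
      rwa [h3]
    · simp [targetRegion, norm_smul, ha, abs_of_pos hrT]
  have hνT : ν * T ≤ R - rT := by
    rw [mul_comm]
    exact (le_div_iff₀ hν0).1 hTR
  -- The scaled Apollonius center when the separation at time `t` is `k • v`. Heading for the
  -- interception point at full speed achieves this at `ta`, where the disc is a homothetic copy
  -- inside the original one.
  set g : ℝ → Plane := fun t => (1 - ν ^ 2) • (R - ν * t) • a + (ν ^ 2 * k) • v with hg
  have hgc : Continuous fun t => ‖g t‖ := by fun_prop
  set ta := (1 - k) * T with hta
  have hta0 : 0 ≤ ta := mul_nonneg (by linarith) hT0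
  have htaT : ta ≤ T := by nlinarith
  have htaR : ta ≤ R / ν := by
    rw [le_div_iff₀ hν0]
    nlinarith
  have hga : (1 - ν ^ 2) * rT + ν * d ≤ ‖g ta‖ := by
    have h1 : ‖(-(ν * T)) • a‖ ≤ ν * ‖(-(ν * T)) • a + v‖ := by
      rw [neg_smul, neg_add_eq_sub, sub_eq_zero.1 hT, norm_neg, norm_smul, ha, mul_one,
        Real.norm_of_nonneg (by positivity)]
    have h2 := norm_smul_sub_smul_le hν0.le hν1.le h1
    have h3 : R • a - ν ^ 2 • (R • a - v) =
        g ta - (1 - k) • ((1 - ν ^ 2) • (-(ν * T)) • a - ν ^ 2 • v) := by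
      simp only [hg, hta]
      module
    have h4 := norm_sub_le (g ta) ((1 - k) • ((1 - ν ^ 2) • (-(ν * T)) • a - ν ^ 2 • v))
    rw [← h3, norm_smul, Real.norm_of_nonneg (by linarith)] at h4
    have h5 := mul_le_mul_of_nonneg_left h2 (sub_nonneg.2 hk1)
    have h6 : (1 - k) * (ν * ‖v‖) = ν * ‖v‖ - ν * d := by rw [← hkv]; ring
    linarith
  have hgR : ‖g (R / ν)‖ ≤ (1 - ν ^ 2) * R - ν * d := by
    have h1 : g (R / ν) = (ν ^ 2 * k) • v := by
      simp [hg, mul_div_cancel₀ _ hν0.ne']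
    rw [h1, norm_smul, Real.norm_of_nonneg (by positivity), mul_assoc, hkv]
    nlinarith [mul_pos hν0 hd0, mul_pos hν2 hrT]
  obtain ⟨t, ht, hlow, hupp⟩ : ∃ t ∈ Icc ta (R / ν), (1 - ν ^ 2) * rT + ν * d ≤ ‖g t‖ ∧
      ‖g t‖ ≤ (1 - ν ^ 2) * R - ν * d := by
    by_cases hcase : ‖g ta‖ ≤ (1 - ν ^ 2) * R - ν * d
    · exact ⟨ta, ⟨le_rfl, htaR⟩, hga, hcase⟩
    · obtain ⟨t, ht, hgt⟩ := intermediate_value_Icc' htaR hgc.continuousOn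
        ⟨hgR, (not_le.1 hcase).le⟩
      refine ⟨t, ht, ?_, hgt.le⟩
      change ‖g t‖ = _ at hgt
      linarith
  -- The required displacement is at most `ta + ν (t - ta) ≤ t`.
  obtain ⟨u, hu, htu⟩ : ∃ u : Plane, ‖u‖ ≤ 1 ∧ t • u = (1 - k) • v - (ν * t) • a := by
    refine exists_smul_eq_of_norm_le ?_
    have h1 : (1 - k) • v - (ν * t) • a =
        (1 - k) • (v - (ν * T) • a) - (ν * (t - ta)) • a := by
      rw [hta]
      module
    rw [h1]
    refine (norm_sub_le _ _).trans ?_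
    rw [norm_smul, norm_smul, sub_eq_zero.1 hT, ha, mul_one, Real.norm_of_nonneg (by linarith),
      Real.norm_of_nonneg (mul_nonneg hν0.le (by linarith [ht.1])), ← hta]
    nlinarith [ht.1]
  have ht0 : 0 ≤ t := hta0.trans ht.1
  have hrel : (R - ν * t) • a - (R • a - v + t • u) = k • v := by
    rw [htu]
    module
  have hrel' : (R - ν * t) • a - ν ^ 2 • (R • a - v + t • u) = g t := by
    rw [htu]
    simp only [hg]
    module
  refine ⟨t, u, ht0, ?_, hu, fun s hs => ?_, ?_, ?_, ?_⟩
  · rw [mul_comm]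
    exact (le_div_iff₀ hν0).1 ht.2
  · obtain ⟨q, hq0, hq1, hsq⟩ : ∃ q : ℝ, 0 ≤ q ∧ q ≤ 1 ∧ s = q * t := by
      rcases ht0.eq_or_lt with h0 | h0
      · exact ⟨0, le_rfl, zero_le_one, by linarith [hs.1, hs.2]⟩
      · exact ⟨s / t, div_nonneg hs.1 ht0, (div_le_one h0).2 hs.2,
          (div_mul_cancel₀ _ h0.ne').symm⟩
    have h1 : (R - ν * s) • a - (R • a - v + s • u) = (1 - q * (1 - k)) • v := by
      rw [hsq, mul_smul q t u, htu]
      module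
    have h2 : k ≤ 1 - q * (1 - k) := by nlinarith
    rw [h1, norm_smul, Real.norm_of_nonneg (hk0.trans h2), ← hkv]
    exact mul_le_mul_of_nonneg_right h2 hvpos.le
  · rw [hrel, norm_smul, Real.norm_of_nonneg hk0, hkv]
  · rw [hrel']
    exact hlow
  · rw [hrel']
    linarith

/-- Radial motion and absence of sensing presuppose each other; the circle is broken at the first
sensing time, up to which the motion is radial, contradicting `hfar`. -/
theorem RadialUntilSensing.eq_of_far {rhoA ν R θ t1 : ℝ} {xA xD : ℝ → Plane}
    (h : RadialUntilSensing rhoA ν R θ xA xD) (hA : ContinuousOn xA (Icc 0 t1))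
    (hD : ContinuousOn xD (Icc 0 t1))
    (hfar : ∀ s ∈ Icc 0 t1, rhoA < ‖(R - ν * s) • unitVec θ - xD s‖) :
    ∀ t ∈ Icc 0 t1, xA t = (R - ν * t) • unitVec θ := by
  suffices hdist : ∀ t ∈ Icc 0 t1, rhoA < dist (xA t) (xD t) from fun t ht =>
    h t ht.1 fun s hs => hdist s ⟨hs.1, hs.2.le.trans ht.2⟩
  by_contra! hne
  obtain ⟨s, hs, hsd⟩ := hne
  set Z := {t ∈ Icc 0 t1 | dist (xA t) (xD t) ≤ rhoA}
  have hZ : IsClosed Z :=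
    isClosed_Icc.isClosed_le (continuous_dist.comp_continuousOn (hA.prodMk hD)) continuousOn_const
  have hbdd : BddBelow Z := ⟨0, fun t ht => ht.1.1⟩
  have hmem : sInf Z ∈ Z := hZ.csInf_mem ⟨s, hs, hsd⟩ hbdd
  have hx := h (sInf Z) hmem.1.1 fun τ hτ => by
    by_contra! hle
    exact (csInf_le hbdd (⟨⟨hτ.1, hτ.2.le.trans hmem.1.2⟩, hle⟩ : τ ∈ Z)).not_gt hτ.2
  have := hfar _ hmem.1
  rw [← hx, ← dist_eq_norm] at this
  exact this.not_ge hmem.2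

theorem canCaptureInside_of_apollonius_outside {rT rhoT rhoA ν θA : ℝ} {xD0 : Plane}
    (hrT : 0 < rT) (hrhoA : 0 ≤ rhoA) (hν0 : 0 < ν) (hν1 : ν < 1) (hrhoT : 0 ≤ rhoT)
    (hrho : 2 * ν * rhoA < (1 - ν ^ 2) * rhoT)
    (hout : (1 - ν ^ 2) * rT + ν * ‖(rhoT + rT) • unitVec θA - xD0‖ ≤
      ‖(rhoT + rT) • unitVec θA - ν ^ 2 • xD0‖)
    (hdist : rhoA < ‖(rhoT + rT) • unitVec θA - xD0‖) :
    CanCaptureInside rT rhoT rhoA ν θA xD0 := by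
  have hν2 : 0 < 1 - ν ^ 2 := by nlinarith
  set R := rhoT + rT with hR
  obtain ⟨d, hAd, hd, hdR⟩ : ∃ d, rhoA < d ∧ d ≤ ‖R • unitVec θA - xD0‖ ∧
      2 * ν * d ≤ (1 - ν ^ 2) * (R - rT) := by
    refine ⟨min ‖R • unitVec θA - xD0‖ ((1 - ν ^ 2) * rhoT / (2 * ν)), lt_min hdist ?_,
      min_le_left _ _, ?_⟩
    · rw [lt_div_iff₀ (by positivity)]
      linarith
    · have h1 := (le_div_iff₀ (by positivity)).1 (min_le_right ‖R • unitVec θA - xD0‖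
        ((1 - ν ^ 2) * rhoT / (2 * ν)))
      have h2 : R - rT = rhoT := by rw [hR]; ring
      rw [h2]
      linarith
  have hd0 : 0 < d := hrhoA.trans_lt hAd
  obtain ⟨t1, u, ht1, htR, hu, hfar, hdd, hlow, hupp⟩ := exists_constant_velocity hrT hν0 hν1
    (norm_unitVec θA) (by linarith) hout hd0 hd hdR
  obtain ⟨e, he, hv⟩ := exists_unit_smul_norm ((R - ν * t1) • unitVec θA - (xD0 + t1 • u))
  rw [hdd] at hv
  refine ⟨pursuit ν t1 u e d xD0, isDefenderStrategy_pursuit hν0.le hν1 he hu ht1,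
    fun x hx hrad => ?_⟩
  have hD : EqOn (pursuit ν t1 u e d xD0 x) (fun s => xD0 + s • u) (Icc 0 t1) :=
    fun s hs => pursuit_of_le x hs.1 hs.2
  have hxr := hrad.eq_of_far (t1 := t1)
    ((hx.continuousOn hν0.le).mono Icc_subset_Ici_self)
    (ContinuousOn.congr (by fun_prop) hD)
    fun s hs => by
      rw [hD hs]
      exact hAd.trans_le (hfar s hs)
  have hx1 := hxr t1 ⟨ht1, le_rfl⟩
  rw [← hx1] at hv hlow hupp
  obtain ⟨T, hT, hcap, hle, hlt⟩ := exists_capture_pursuit hν0 hν1 he hu ht1 hd0.le hx hv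
  have hT1 : t1 < T := by
    refine lt_of_le_of_ne hT fun h => ?_
    rw [← h, hD ⟨ht1, le_rfl⟩, ← sub_eq_zero, hv] at hcap
    have := congrArg norm hcap
    rw [norm_smul, he, norm_zero, mul_one, Real.norm_of_nonneg hd0.le] at this
    exact hd0.ne' this
  have hlate : ∀ t ∈ Ico t1 T, x t ∉ targetRegion rT := fun t ht =>
    notMem_targetRegion_of_norm_lt hν2.le hlow (hlt t ht)
  have hnorm : ∀ t ∈ Icc 0 t1, ‖x t‖ = R - ν * t := fun t ht => by
    have : ν * t ≤ ν * t1 := mul_le_mul_of_nonneg_left ht.2 hν0.le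
    rw [hxr t ht, norm_smul, norm_unitVec, mul_one, Real.norm_of_nonneg (by linarith)]
  refine ⟨T, ⟨ht1.trans hT, hcap, fun t ht => ?_⟩, fun t ht => ?_⟩
  · rcases le_total t1 t with h | h
    · exact hlate t ⟨h, ht.2⟩
    · have h1 := hlate t1 ⟨le_rfl, hT1⟩
      have h2 : ν * t ≤ ν * t1 := mul_le_mul_of_nonneg_left h hν0.le
      rw [targetRegion, mem_closedBall_zero_iff, hnorm _ ⟨ht1, le_rfl⟩] at h1
      rw [targetRegion, mem_closedBall_zero_iff, hnorm _ ⟨ht.1, h⟩]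
      linarith
  · rw [sensingDisc, mem_closedBall_zero_iff]
    rcases le_total t1 t with h | h
    · exact norm_le_of_norm_smul_sub_le hν2 hupp (hle t ⟨h, ht.2⟩)
    · rw [hnorm _ ⟨ht.1, h⟩]
      have := mul_nonneg hν0.le ht.1
      linarith

theorem lemma2 (rT rhoT rhoA ν r θA θD : ℝ)
    (hrT : 0 < rT) (hrhoA : 0 ≤ rhoA) (hν0 : 0 < ν) (hν1 : ν < 1)
    (hAsm : max ((1 + 2 * ν / (1 - ν ^ 2)) * rhoA)
      (ν * rT + 2 * rhoA * ν ^ 2 / (1 - ν ^ 2)) ≤ rhoT)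
    (hr0 : 0 ≤ r) (hr : r ≤ rhoT + rT) :
    (rhoT / ν - rT < r → guardRadicand rT rhoT ν r ∈ Set.Icc (0 : ℝ) 1) ∧
    ((|θA - θD| ≤ if rhoT / ν - rT < r then guardAngle rT rhoT ν r else Real.pi) →
      CanCapture rT ν ((rhoT + rT) • unitVec θA) (r • unitVec θD) ∧
      (rhoA < dist ((rhoT + rT) • unitVec θA) (r • unitVec θD) →
        CanCaptureInside rT rhoT rhoA ν θA (r • unitVec θD))) := by
  have hν2 : 0 < 1 - ν ^ 2 := by nlinarith
  obtain ⟨h1, h2⟩ := max_le_iff.1 hAsm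
  have hrho : ν * rT ≤ rhoT := by
    have : 0 ≤ 2 * rhoA * ν ^ 2 / (1 - ν ^ 2) := by positivity
    linarith
  have hrho0 : 0 < rhoT := lt_of_lt_of_le (by positivity) hrho
  -- Strictness leaves room for a separation `d > rhoA` whose Apollonius disc fits in the annulus.
  have hrho' : 2 * ν * rhoA < (1 - ν ^ 2) * rhoT := by
    have h3 : (1 - ν ^ 2) * ((1 + 2 * ν / (1 - ν ^ 2)) * rhoA) =
        (1 - ν ^ 2) * rhoA + 2 * ν * rhoA := by
      field_simp
    have h4 := mul_le_mul_of_nonneg_left h1 hν2.le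
    rw [h3] at h4
    rcases hrhoA.eq_or_lt with h0 | h0
    · rw [← h0, mul_zero]
      positivity
    · linarith [mul_pos hν2 h0]
  refine ⟨guardRadicand_mem_Icc hrT hν0 hν1 hrho hr, fun hθ => ?_⟩
  have hout := apollonius_outside_target hrT hν0 hν1 hrho hr0 hr hθ
  refine ⟨canCapture_of_apollonius_outside hν0 hν1 hout, fun hdist => ?_⟩
  rw [dist_eq_norm] at hdist
  exact canCaptureInside_of_apollonius_outside hrT hrhoA hν0 hν1 hrho0.le hrho' hout hdist
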